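/- Let $n\ge 3$ and let $B_n$ be the braid group on $n$ strands, given by Artin's presentation with generators $\sigma_1,\dots,\sigma_{n-1}$ and relations $\sigma_k\sigma_{k+1}\sigma_k=\sigma_{k+1}\sigma_k\sigma_{k+1}$ for $1\le k\le n-2$ and $\sigma_j\sigma_k=\sigma_k\sigma_j$ for $|j-k|>1$. Let $\Gamma$ be the Cayley graph of $B_n$ with respect to the generators $\sigma_k^{\pm1}$ (edges join $g$ and $gs$), and let $d$ be its path metric. For a metric space $(X,d)$ let $\mathcal G(X,d)$ be the closed $*$-subalgebra of the bounded continuous complex functions on $X$ generated by the functions vanishing at infinity, the constants, and the functions $\varphi_{y,z}(x)=d(x,y)-d(x,z)$ for $y,z\in X$. The metric compactification $\overline X_d$ is the maximal ideal space (space of characters) of $\mathcal G(X,d)$, which contains $X$ via point evaluations, and the metric boundary is $\partial_dX=\overline X_d\setminus X$. An almost-geodesic ray is a map $\gamma:T\to X$, where $T\subseteq[0,\infty)$ is unbounded and contains $0$, such that for every $\varepsilon>0$ there is an integer $N$ with $|d(\gamma(t),\gamma(s))+d(\gamma(s),\gamma(0))-t|<\varepsilon$ for all $s,t\in T$ with $t\ge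 s\ge N$. A Busemann point is a point of $\partial_dX$ that is the limit of $\gamma(t)$, as $t\to\infty$, for some almost-geodesic ray $\gamma$. Then the metric boundary of $(B_n,d)$ contains a point that is not a Busemann point. More precisely, for $1\le k\le n-2$ and signs $\varepsilon,\delta\in\{1,-1\}$ put $$a=\sigma_k^{\varepsilon},\qquad b=\sigma_{k+1}^{-\varepsilon},\qquad c_m=\sigma_k^{\varepsilon}\,\sigma_{k+1}^{\delta m}\,\sigma_k^{-\varepsilon}\quad(m=0,1,2,\dots),$$ and let $L_{k,\varepsilon,\delta}\subseteq\overline{(B_n)}_d$ be the set of limit points of the sequence $(c_m)_{m\ge0}$. Then: 1. $\Gamma$ is connected, $B_n$ is countable, every vertex of $\Gamma$ has finite valence, and for every $m\ge 0$ the triple $\{a,b,c_m\}$ has perimeter $d(a,b)+d(b,c_m)+d(c_m,a)\ge m$ and no minimal path from $a$ to $c_m$ shares a tail (a common final segment with at least one edge) with a minimal path from $b$ to $c_m$. 2. $L_{k,\varepsilon,\delta}$ is non-empty, and each of its elements is a point of $\partial_d B_n$ that is not a Busemann point. 3. For each fixed $k$, the four sets $L_{k,1,1}$, $L_{k,1,-1}$,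 $L_{k,-1,1}$, $L_{k,-1,-1}$ are pairwise disjoint; so there are at least four distinct non-empty sets of non-Busemann points. -/

import Mathlib

open Filter Topology
open scoped BoundedContinuousFunction

noncomputable section

namespace MetricCompactification

/-! ### The metric compactification of a metric space -/

section Metric

variable (X : Type*) [MetricSpace X]

/-- The function `φ_{y,z}(x) = d(x,y) - d(x,z)`, a bounded continuous (complex-valued) function. -/
def phi (y z : X) : X →ᵇ ℂ :=
  BoundedContinuousFunction.ofNormedAddCommGroup
    (fun x => ((dist x y - dist x z : ℝ) : ℂ)) (by fun_prop) (dist y z) (by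
      intro x
      rw [Complex.norm_real, Real.norm_eq_abs, dist_comm x y, dist_comm x z]
      exact abs_dist_sub_le y z x)

/-- The C*-algebra `𝒢(X,d)`: the closed (star-)subalgebra of `C_b(X)` generated by the functions
vanishing at infinity, the constants (which lie in every unital subalgebra), and the functions
`φ_{y,z}`. -/
def metricAlgebra : StarSubalgebra ℂ (X →ᵇ ℂ) :=
  (StarAlgebra.adjoin ℂ
    ({f : X →ᵇ ℂ | Tendsto f (cocompact X) (𝓝 0)} ∪
      {f : X →ᵇ ℂ | ∃ y z : X, f = phi X y z})).topologicalClosure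

/-- The metric compactification: the maximal ideal space of `𝒢(X,d)`, i.e. its space of
characters with the weak-* topology. -/
abbrev Compactification : Type _ :=
  WeakDual.characterSpace ℂ (metricAlgebra X)

variable {X}

/-- The natural inclusion of `X` in its metric compactification, by point evaluations. -/
def ofPoint (x : X) : Compactification X :=
  ⟨((BoundedContinuousFunction.evalCLM ℂ x).comp
      (metricAlgebra X).toSubalgebra.toSubmodule.subtypeL : metricAlgebra X →L[ℂ] ℂ), by
    constructor
    · intro h
      have h1 : (((BoundedContinuousFunction.evalCLM ℂ x).comp
        (metricAlgebra X).toSubalgebra.toSubmodule.subtypeL :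
          metricAlgebra X →L[ℂ] ℂ)) (1 : metricAlgebra X) = 0 :=
        congrArg (fun L : metricAlgebra X →L[ℂ] ℂ => L 1) h
      exact one_ne_zero (α := ℂ) h1
    · intro f g
      rfl⟩

theorem ofPoint_apply (x : X) (f : metricAlgebra X) :
    ofPoint x f = (f : X →ᵇ ℂ) x := rfl

variable (X) in
/-- The metric boundary: the points of the compactification that are not points of `X`. -/
def boundary : Set (Compactification X) := (Set.range (ofPoint (X := X)))ᶜ

/-- `γ : T → X` is an almost-geodesic ray, where `T ⊆ [0, ∞)` is unbounded and contains `0`. -/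
structure IsAlmostGeodesicRay (T : Set ℝ) (γ : T → X) : Prop where
  nonneg : ∀ t ∈ T, 0 ≤ t
  unbounded : ¬ BddAbove T
  zero_mem : (0 : ℝ) ∈ T
  almost : ∀ ε : ℝ, 0 < ε → ∃ N : ℤ, ∀ s t : T, (N : ℝ) ≤ s → s ≤ t →
    |dist (γ t) (γ s) + dist (γ s) (γ ⟨0, zero_mem⟩) - t| < ε

/-- A Busemann point: a point of the metric boundary that is the limit (as `t → ∞`) of an
almost-geodesic ray. -/
def IsBusemannPoint (ω : Compactification X) : Prop :=
  ω ∈ boundary X ∧ ∃ (T : Set ℝ) (γ : T → X), IsAlmostGeodesicRay T γ ∧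
    Tendsto (fun t => ofPoint (γ t)) atTop (𝓝 ω)

/-- The set of limit points in the metric compactification of a sequence of points of `X`
(the compactification is metrizable when `X` is locally compact and separable, so that these are the limits of the
convergent subsequences). -/
def limitPoints (c : ℕ → X) : Set (Compactification X) :=
  {ω | MapClusterPt ω atTop (fun m => ofPoint (c m))}

end Metric

/-! ### Graphs -/

section Graph

variable {V : Type*} (G : SimpleGraph V)

/-- The path metric on the vertices of a connected graph. -/
abbrev pathMetric (h : G.Connected) : MetricSpace V where
  dist x y := (G.dist x y : ℝ)
  dist_self x := by simp
  dist_comm x y := by simp [G.dist_comm]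
  dist_triangle x y z := by exact_mod_cast h.dist_triangle
  eq_of_dist_eq_zero := by
    intro x y hxy
    exact h.dist_eq_zero_iff.mp (by exact_mod_cast hxy)

/-- The perimeter of a triple of vertices. -/
def perimeter (a b c : V) : ℕ := G.dist a b + G.dist b c + G.dist c a

variable {G} in
/-- A path is minimal when its length is the distance between its ends. -/
def IsMinimalPath {u v : V} (p : G.Walk u v) : Prop := p.length = G.dist u v

variable {G} in
/-- Two paths with the same end share a tail: they end in a common path with at least one edge. -/
def ShareTail {a b c : V} (p : G.Walk a c) (q : G.Walk b c) : Prop :=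
  ∃ (v : V) (p' : G.Walk a v) (q' : G.Walk b v) (r : G.Walk v c),
    0 < r.length ∧ p = p'.append r ∧ q = q'.append r

/-- The criterion for non-Busemann points in the metric boundary of a graph: the graph
is connected, countable and of finite valence, and `c n` is a sequence of vertices such that
the triple `{a, b, c n}` has perimeter at least `n` and no minimal paths `[a, c n]`, `[b, c n]`
share a tail. -/
structure NonBusemannCriterion (a b : V) (c : ℕ → V) : Prop where
  connected : G.Connected
  countable : Countable V
  finite_valence : ∀ v, (G.neighborSet v).Finite
  le_perimeter : ∀ n, n ≤ perimeter G a b (c n)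
  not_shareTail : ∀ n (p : G.Walk a (c n)) (q : G.Walk b (c n)),
    IsMinimalPath p → IsMinimalPath q → ¬ ShareTail p q

/-- The Cayley graph with respect to a generating set of a group is connected. -/
theorem mulCayley_connected {M : Type*} [Group M] (S : Set M) (hS : Subgroup.closure S = ⊤) :
    (SimpleGraph.mulCayley S).Connected := by
  have step : ∀ (g s : M), s ∈ S → (SimpleGraph.mulCayley S).Reachable g (g * s) := by
    intro g s hs
    by_cases h : g = g * s
    · rw [← h]
    · exact SimpleGraph.Adj.reachable (by
        rw [SimpleGraph.mulCayley_adj]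
        exact ⟨h, Or.inl (by simpa using hs)⟩)
  have key : ∀ x ∈ Subgroup.closure S, ∀ g, (SimpleGraph.mulCayley S).Reachable g (g * x) := by
    intro x hx
    induction hx using Subgroup.closure_induction with
    | mem s hs => exact fun g => step g s hs
    | one => intro g; rw [mul_one]
    | mul x y _ _ hx hy => intro g; rw [← mul_assoc]; exact (hx g).trans (hy _)
    | inv x _ hx => intro g; simpa using (hx (g * x⁻¹)).symm
  have : Nonempty M := ⟨1⟩
  refine ⟨fun u v => ?_⟩
  simpa using key (u⁻¹ * v) (by rw [hS]; trivial) u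

end Graph

end MetricCompactification

/-! ### Braid groups -/

open MetricCompactification

/-- The relators of the braid group on `n` strands, on generators indexed by `0, …, n - 2`. -/
def braidRelators (n : ℕ) : Set (FreeGroup (Fin (n - 1))) :=
  {r | ∃ i j : Fin (n - 1), (i : ℕ) + 1 = j ∧
    r = (FreeGroup.of i * FreeGroup.of j * FreeGroup.of i) *
      (FreeGroup.of j * FreeGroup.of i * FreeGroup.of j)⁻¹} ∪
  {r | ∃ i j : Fin (n - 1), (i : ℕ) + 1 < j ∧
    r = (FreeGroup.of i * FreeGroup.of j) * (FreeGroup.of j * FreeGroup.of i)⁻¹}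

/-- The braid group on `n` strands, by Artin's presentation. -/
def BraidGroup (n : ℕ) : Type := PresentedGroup (braidRelators n)

namespace BraidGroup

instance (n : ℕ) : Group (BraidGroup n) :=
  inferInstanceAs (Group (PresentedGroup (braidRelators n)))

/-- The Artin generators. -/
def sigma {n : ℕ} (i : Fin (n - 1)) : BraidGroup n := PresentedGroup.of i

/-- The Cayley graph of the braid group with respect to the Artin generators and their inverses
(edges join `g` to `g * s`, and are undirected). -/
def cayleyGraph (n : ℕ) : SimpleGraph (BraidGroup n) :=
  SimpleGraph.mulCayley (Set.range sigma)

theorem cayleyGraph_connected (n : ℕ) : (cayleyGraph n).Connected :=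
  mulCayley_connected _ (PresentedGroup.closure_range_of (braidRelators n))

/-- The braid group carries the path metric of its Cayley graph. -/
instance (n : ℕ) : MetricSpace (BraidGroup n) :=
  pathMetric (cayleyGraph n) (cayleyGraph_connected n)

/-- The third vertex `x^ε y^{δ m} x^{-ε}` of the triple
`{x^ε, y^{-ε}, x^ε y^{δ m} x^{-ε}}`, for signs `ε, δ ∈ {1, -1}`. -/
def apex {n : ℕ} (x y : BraidGroup n) (ε δ : ℤˣ) (m : ℕ) : BraidGroup n :=
  x ^ (ε : ℤ) * y ^ ((δ : ℤ) * (m : ℤ)) * x ^ (-(ε : ℤ))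

end BraidGroup

end

/-! Distances in a graph are integers, so limits of the functions `phi` are reached exactly. A
Busemann point therefore lies behind some vertex `p` on the ray: geodesics from `a`, and from `b`,
towards the point can be taken through `p` (`IsBusemannPoint.exists_phiVal_eq_dist`). If it were a
limit point of `c`, then for infinitely many `m` minimal paths to `c m` from `a` and from `b` would
both run through `p` and share the tail from `p` to `c m`, non-trivial because the perimeters grow.
So the absence of shared tails rules out Busemann points.

For braids, inverting all generators and exchanging the two generators reduce the four sign choices
to c = σ_i σ_j^m σ_i⁻¹ = σ_j⁻¹ σ_i^m σ_j, with a = σ_i and b = σ_j⁻¹. Here a⁻¹c = σ_j^m σ_i⁻¹ and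
b⁻¹c = σ_i^m σ_j, each of length at most m + 1. Exponent sums show that a last edge closer to b
removes a letter σ_k and leaves a positive braid. The Burau representation at t = 2 then forces k =
j (`Consecutive.eq_of_signedWord`): positive braids act integrally, and σ_k kills one basis vector
modulo 2. If that edge were also closer to a, then σ_j^m σ_i⁻¹ σ_j⁻¹ would have length at most m;
but it has a matrix entry 1/4, so it needs two inverse letters and its length is at least m + 2
(`Consecutive.two_le_of_signedWord`).

The limit sets are separated by functions `phi` with values at most -1 along one sequence and at
least 1 along the other. -/

noncomputable section

open MetricCompactification

namespace MetricCompactification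

/-! ### Limit points as characters -/

section Characters

variable {X : Type*} [MetricSpace X]

/-- The function `φ_{y,z}` as an element of `𝒢(X,d)`. -/
def phiElem (y z : X) : metricAlgebra X :=
  ⟨phi X y z, StarSubalgebra.le_topologicalClosure _
    (StarAlgebra.subset_adjoin ℂ _ (Or.inr ⟨y, z, rfl⟩))⟩

theorem ofPoint_phiElem (x y z : X) :
    ofPoint x (phiElem y z) = ((dist x y - dist x z : ℝ) : ℂ) := rfl

theorem continuous_apply (f : metricAlgebra X) :
    Continuous fun ω : Compactification X => ω f :=
  (WeakDual.eval_continuous f).comp continuous_subtype_val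

/-- The value of the real function `φ_{y,z}` at a point of the compactification. -/
def phiVal (y z : X) (ω : Compactification X) : ℝ := (ω (phiElem y z)).re

theorem continuous_phiVal (y z : X) : Continuous (phiVal y z) :=
  Complex.continuous_re.comp (continuous_apply _)

theorem phiVal_ofPoint (x y z : X) : phiVal y z (ofPoint x) = dist x y - dist x z := by
  rw [phiVal, ofPoint_phiElem, Complex.ofReal_re]

theorem compactSpace_compactification : CompactSpace (Compactification X) := by
  have : CompleteSpace (metricAlgebra X) :=
    (StarSubalgebra.isClosed_topologicalClosure _).completeSpace_coe
  infer_instance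

theorem limitPoints_nonempty (c : ℕ → X) : (limitPoints c).Nonempty := by
  have := compactSpace_compactification (X := X)
  obtain ⟨ω, hω⟩ := exists_clusterPt_of_compactSpace (map (fun m => ofPoint (c m)) atTop)
  exact ⟨ω, hω⟩

theorem mem_of_mem_limitPoints {c : ℕ → X} {ω : Compactification X} (hω : ω ∈ limitPoints c)
    {S : Set (Compactification X)} (hS : IsClosed S) (h : ∀ᶠ m in atTop, ofPoint (c m) ∈ S) :
    ω ∈ S :=
  hS.mem_of_mapClusterPt (b := atTop) (f := fun m => ofPoint (c m)) hω h

theorem mem_boundary_of_mem_limitPoints [DiscreteTopology X] {c : ℕ → X}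
    (hc : ∀ p, ∀ᶠ m in atTop, c m ≠ p) {ω : Compactification X} (hω : ω ∈ limitPoints c) :
    ω ∈ boundary X := by
  classical
  rintro ⟨p, rfl⟩
  -- The indicator of `p` vanishes at infinity, so it belongs to the algebra and isolates `p` from
  -- the sequence.
  let f : X →ᵇ ℂ := BoundedContinuousFunction.ofNormedAddCommGroupDiscrete
    (fun x => if x = p then 1 else 0) 1 (by intro x; split_ifs <;> simp)
  have hf : f ∈ metricAlgebra X := by
    refine StarSubalgebra.le_topologicalClosure _ (StarAlgebra.subset_adjoin ℂ _ (Or.inl ?_))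
    refine tendsto_const_nhds.congr' ?_
    filter_upwards [(isCompact_singleton (x := p)).compl_mem_cocompact] with x hx
    exact (if_neg hx).symm
  have hcl : IsClosed {ω : Compactification X | ω ⟨f, hf⟩ = 0} :=
    isClosed_eq (continuous_apply _) continuous_const
  have h0 : ofPoint p ⟨f, hf⟩ = 0 :=
    mem_of_mem_limitPoints hω hcl ((hc p).mono fun m hm => if_neg hm)
  have h1 : ofPoint p ⟨f, hf⟩ = 1 := if_pos rfl
  exact one_ne_zero (h1.symm.trans h0)

theorem disjoint_limitPoints {c c' : ℕ → X} (p q : X)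
    (h : ∀ᶠ m in atTop, dist (c m) p - dist (c m) q ≤ -1)
    (h' : ∀ᶠ m in atTop, 1 ≤ dist (c' m) p - dist (c' m) q) :
    Disjoint (limitPoints c) (limitPoints c') := by
  rw [Set.disjoint_left]
  intro ω hω hω'
  have h1 : phiVal p q ω ≤ -1 :=
    mem_of_mem_limitPoints hω (isClosed_le (continuous_phiVal p q) continuous_const)
      (h.mono fun m hm => by simpa only [Set.mem_ofPred_eq, phiVal_ofPoint] using hm)
  have h2 : 1 ≤ phiVal p q ω :=
    mem_of_mem_limitPoints hω' (isClosed_le continuous_const (continuous_phiVal p q))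
      (h'.mono fun m hm => by simpa only [Set.mem_ofPred_eq, phiVal_ofPoint] using hm)
  linarith

end Characters

/-! ### Busemann points of graphs -/

section GraphMetric

variable {V : Type*} [MetricSpace V] {G : SimpleGraph V}

theorem exists_int_dist_sub (hd : ∀ x y, dist x y = (G.dist x y : ℝ)) (x y z : V) :
    ∃ k : ℤ, dist x y - dist x z = k :=
  ⟨(G.dist x y : ℤ) - G.dist x z, by rw [hd, hd]; push_cast; rfl⟩

theorem eq_of_abs_sub_lt_one {r s : ℝ} (hr : ∃ k : ℤ, r = k) (hs : ∃ k : ℤ, s = k)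
    (h : |r - s| < 1) : r = s := by
  obtain ⟨k, rfl⟩ := hr
  obtain ⟨l, rfl⟩ := hs
  have : |k - l| < 1 := by exact_mod_cast h
  have : k - l = 0 := Int.abs_lt_one_iff.mp this
  rw [sub_eq_zero.mp this]

/-- An almost-geodesic ray of a graph eventually runs along geodesics from its origin. -/
theorem IsAlmostGeodesicRay.exists_dist_add_eq (hd : ∀ x y, dist x y = (G.dist x y : ℝ))
    {T : Set ℝ} {γ : T → V} (hγ : IsAlmostGeodesicRay T γ) :
    ∃ s₀ : T, ∀ s t : T, s₀ ≤ s → s ≤ t →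
      dist (γ t) (γ s) + dist (γ s) (γ ⟨0, hγ.zero_mem⟩) = dist (γ t) (γ ⟨0, hγ.zero_mem⟩) := by
  obtain ⟨N, hN⟩ := hγ.almost (1 / 4) (by norm_num)
  obtain ⟨s₀, hs₀, hlt⟩ := not_bddAbove_iff.mp hγ.unbounded N
  refine ⟨⟨s₀, hs₀⟩, fun s t hs hst => ?_⟩
  have hNs : (N : ℝ) ≤ s := hlt.le.trans hs
  have h1 := hN s t hNs hst
  -- The pair (t, t) compares the parameter t with the distance from the origin. Eliminating t
  -- leaves an error below 1/2, hence none.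
  have h2 := hN t t (hNs.trans hst) le_rfl
  rw [dist_self, zero_add] at h2
  refine eq_of_abs_sub_lt_one (s := dist (γ t) (γ ⟨0, hγ.zero_mem⟩))
    ⟨(G.dist (γ t) (γ s) : ℤ) + G.dist (γ s) (γ ⟨0, hγ.zero_mem⟩), ?_⟩
    ⟨(G.dist (γ t) (γ ⟨0, hγ.zero_mem⟩) : ℤ), ?_⟩ ?_
  · rw [hd, hd]; push_cast; rfl
  · rw [hd]; push_cast; rfl
  · rw [abs_lt] at h1 h2 ⊢
    constructor <;> linarith [h1.1, h1.2, h2.1, h2.2]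

/-- Along a convergent almost-geodesic ray the functions `φ_{p,q}` are eventually constant. -/
theorem exists_forall_dist_sub_eq (hd : ∀ x y, dist x y = (G.dist x y : ℝ))
    {T : Set ℝ} (hT : T.Nonempty) {γ : T → V} {ω : Compactification V}
    (hω : Tendsto (fun t => ofPoint (γ t)) atTop (𝓝 ω)) (p q : V) :
    ∃ s₁ : T, ∀ t, s₁ ≤ t →
      dist (γ t) p - dist (γ t) q = dist (γ s₁) p - dist (γ s₁) q := by
  have : Nonempty T := hT.to_subtype
  have hlim : Tendsto (fun t => dist (γ t) p - dist (γ t) q) atTop (𝓝 (phiVal p q ω)) := by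
    simpa only [Function.comp_def, phiVal_ofPoint] using
      ((continuous_phiVal p q).tendsto ω).comp hω
  obtain ⟨s₁, hs₁⟩ := eventually_atTop.mp
    (hlim.eventually (Metric.ball_mem_nhds _ (by norm_num : (0 : ℝ) < 1 / 2)))
  refine ⟨s₁, fun t ht => eq_of_abs_sub_lt_one (exists_int_dist_sub hd _ _ _)
    (exists_int_dist_sub hd _ _ _) ?_⟩
  have h1 := hs₁ t ht
  have h2 := hs₁ s₁ le_rfl
  rw [Real.dist_eq, abs_lt] at h1 h2
  rw [abs_lt]
  constructor <;> linarith [h1.1, h1.2, h2.1, h2.2]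

/-- A Busemann point of a graph lies behind some vertex, as seen from any two vertices. -/
theorem IsBusemannPoint.exists_phiVal_eq_dist (hd : ∀ x y, dist x y = (G.dist x y : ℝ))
    {ω : Compactification V} (hω : IsBusemannPoint ω) (a b : V) :
    ∃ p, phiVal a p ω = dist a p ∧ phiVal b p ω = dist b p := by
  obtain ⟨-, T, γ, hγ, hlim⟩ := hω
  have hT : T.Nonempty := ⟨0, hγ.zero_mem⟩
  have : Nonempty T := hT.to_subtype
  obtain ⟨s₀, hs₀⟩ := hγ.exists_dist_add_eq hd
  obtain ⟨s₁, hs₁⟩ := exists_forall_dist_sub_eq hd hT hlim a (γ s₀)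
  obtain ⟨s₂, hs₂⟩ := exists_forall_dist_sub_eq hd hT hlim b (γ s₀)
  let s : T := max s₀ (max s₁ s₂)
  have hs0 : s₀ ≤ s := le_max_left _ _
  have hs1 : s₁ ≤ s := (le_max_left _ _).trans (le_max_right _ _)
  have hs2 : s₂ ≤ s := (le_max_right _ _).trans (le_max_right _ _)
  have key : ∀ z (s' : T), s' ≤ s →
      (∀ t, s' ≤ t → dist (γ t) z - dist (γ t) (γ s₀) = dist (γ s') z - dist (γ s') (γ s₀)) →
      phiVal z (γ s) ω = dist z (γ s) := by
    intro z s' hs' hz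
    refine tendsto_nhds_unique (((continuous_phiVal z (γ s)).tendsto ω).comp hlim)
      (tendsto_const_nhds.congr' ?_)
    -- Geodesicity puts `γ s` between `γ s₀` and `γ t`. Constancy of the difference with base `γ s₀`
    -- then puts `γ s` between `z` and `γ t`.
    filter_upwards [eventually_ge_atTop s] with t ht
    have e1 := hs₀ s t hs0 ht
    have e2 := hs₀ s₀ t le_rfl (hs0.trans ht)
    have e3 := hs₀ s₀ s le_rfl hs0
    have e4 := hz t (hs'.trans ht)
    have e5 := hz s hs'
    rw [Function.comp_apply, phiVal_ofPoint, dist_comm z]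
    linarith
  exact ⟨γ s, key a s₁ hs1 hs₁, key b s₂ hs2 hs₂⟩

theorem NonBusemannCriterion.eventually_ne {V : Type*} {G : SimpleGraph V} {a b : V} {c : ℕ → V}
    (h : NonBusemannCriterion G a b c) (p : V) : ∀ᶠ m in atTop, c m ≠ p := by
  filter_upwards [eventually_gt_atTop (perimeter G a b p)] with m hm hp
  have := h.le_perimeter m
  rw [hp] at this
  omega

theorem NonBusemannCriterion.not_isBusemannPoint (hd : ∀ x y, dist x y = (G.dist x y : ℝ))
    {a b : V} {c : ℕ → V} (h : NonBusemannCriterion G a b c) {ω : Compactification V}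
    (hω : ω ∈ limitPoints c) : ¬ IsBusemannPoint ω := by
  intro hB
  obtain ⟨p, hpa, hpb⟩ := hB.exists_phiVal_eq_dist hd a b
  have near : ∀ z, phiVal z p ω = dist z p →
      ∀ᶠ ω' in 𝓝 ω, phiVal z p ω' ∈ Metric.ball (dist z p) 1 := fun z hz =>
    (continuous_phiVal z p).continuousAt.eventually
      (hz ▸ Metric.ball_mem_nhds _ one_pos)
  obtain ⟨m, ⟨hma, hmb⟩, hne⟩ :=
    ((MapClusterPt.frequently hω ((near a hpa).and (near b hpb))).and_eventually
      (h.eventually_ne p)).exists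
  have dist_add : ∀ z, phiVal z p (ofPoint (c m)) ∈ Metric.ball (dist z p) 1 →
      G.dist z p + G.dist p (c m) = G.dist z (c m) := by
    intro z hz
    rw [phiVal_ofPoint, Metric.mem_ball, Real.dist_eq] at hz
    have := eq_of_abs_sub_lt_one (exists_int_dist_sub hd _ _ _)
      ⟨(G.dist z p : ℤ), by rw [hd]; push_cast; rfl⟩ hz
    rw [dist_comm (c m), dist_comm (c m), hd, hd, hd] at this
    have h' : (G.dist z p : ℝ) + G.dist p (c m) = G.dist z (c m) := by linarith
    exact_mod_cast h'
  obtain ⟨r, hr⟩ := h.connected.exists_walk_length_eq_dist p (c m)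
  obtain ⟨p', hp'⟩ := h.connected.exists_walk_length_eq_dist a p
  obtain ⟨q', hq'⟩ := h.connected.exists_walk_length_eq_dist b p
  refine h.not_shareTail m (p'.append r) (q'.append r) ?_ ?_ ⟨p, p', q', r, ?_, rfl, rfl⟩
  · rw [IsMinimalPath, SimpleGraph.Walk.length_append, hp', hr, dist_add a hma]
  · rw [IsMinimalPath, SimpleGraph.Walk.length_append, hq', hr, dist_add b hmb]
  · rw [hr]
    exact h.connected.pos_dist_of_ne hne.symm

theorem discreteTopology_of_dist_eq (hG : G.Connected) (hd : ∀ x y, dist x y = (G.dist x y : ℝ)) :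
    DiscreteTopology V :=
  DiscreteTopology.of_forall_le_dist one_pos fun x y hxy => by
    simp only [hd]
    exact_mod_cast hG.pos_dist_of_ne hxy

/-- Minimal paths cannot share a tail when no edge into their common end is closer to both of
their origins. -/
theorem not_shareTail_of_forall_adj {V : Type*} {G : SimpleGraph V} (hG : G.Connected) {a b c : V}
    (h : ∀ w, G.Adj w c → G.dist a w + 1 = G.dist a c → G.dist b w + 1 = G.dist b c → False)
    (p : G.Walk a c) (q : G.Walk b c) (hp : IsMinimalPath p) (hq : IsMinimalPath q) :
    ¬ ShareTail p q := by
  rintro ⟨v, p', q', r, hr, rfl, rfl⟩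
  cases r with
  | nil => simp at hr
  | cons hadj r =>
    -- The common tail is split at its last edge instead of its first.
    obtain ⟨w, r', hw, e⟩ := SimpleGraph.Walk.exists_cons_eq_concat hadj r
    rw [e] at hp hq
    have closer : ∀ {z} (s : G.Walk z v), IsMinimalPath (s.append (r'.concat hw)) →
        G.dist z w + 1 = G.dist z c := by
      intro z s hs
      rw [IsMinimalPath, SimpleGraph.Walk.length_append, SimpleGraph.Walk.length_concat] at hs
      have h1 := SimpleGraph.dist_le (s.append r')
      rw [SimpleGraph.Walk.length_append] at h1
      have h2 := hG.dist_triangle (u := z) (v := w) (w := c)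
      rw [SimpleGraph.dist_eq_one_iff_adj.mpr hw] at h2
      omega
    exact h w hw (closer p' hp) (closer q' hq)

end GraphMetric

end MetricCompactification

namespace BraidGroup

variable {n : ℕ}

/-! ### Artin's presentation, exponent sum and mirror automorphism -/

section Presentation

/-- The universal property of the braid group. -/
def lift {H : Type*} [Group H] (f : Fin (n - 1) → H)
    (hbraid : ∀ i j : Fin (n - 1), (i : ℕ) + 1 = j → f i * f j * f i = f j * f i * f j)
    (hcomm : ∀ i j : Fin (n - 1), (i : ℕ) + 1 < j → f i * f j = f j * f i) :
    BraidGroup n →* H :=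
  PresentedGroup.toGroup (rels := braidRelators n) (f := f) (by
    rintro r (⟨i, j, hij, rfl⟩ | ⟨i, j, hij, rfl⟩)
    · rw [map_mul, map_inv, mul_inv_eq_one]
      simpa using hbraid i j hij
    · rw [map_mul, map_inv, mul_inv_eq_one]
      simpa using hcomm i j hij)

theorem lift_sigma {H : Type*} [Group H] (f : Fin (n - 1) → H) (hbraid hcomm)
    (k : Fin (n - 1)) : lift f hbraid hcomm (sigma k) = f k :=
  PresentedGroup.toGroup.of _

theorem sigma_braid {i j : Fin (n - 1)} (h : (i : ℕ) + 1 = j) :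
    (sigma i * sigma j * sigma i : BraidGroup n) = sigma j * sigma i * sigma j := by
  refine mul_inv_eq_one.mp ?_
  exact PresentedGroup.one_of_mem (rels := braidRelators n) (Or.inl ⟨i, j, h, rfl⟩)

theorem sigma_comm {i j : Fin (n - 1)} (h : (i : ℕ) + 1 < j) :
    (sigma i * sigma j : BraidGroup n) = sigma j * sigma i := by
  refine mul_inv_eq_one.mp ?_
  exact PresentedGroup.one_of_mem (rels := braidRelators n) (Or.inr ⟨i, j, h, rfl⟩)

/-- Consecutive indices, in either order. -/
def Consecutive (i j : Fin (n - 1)) : Prop := (i : ℕ) + 1 = j ∨ (j : ℕ) + 1 = i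

theorem Consecutive.symm {i j : Fin (n - 1)} (h : Consecutive i j) : Consecutive j i :=
  Or.symm h

theorem Consecutive.braid {i j : Fin (n - 1)} (h : Consecutive i j) :
    (sigma i * sigma j * sigma i : BraidGroup n) = sigma j * sigma i * sigma j :=
  h.elim sigma_braid fun h => (sigma_braid h).symm

/-- The braid relation is the case `m = 1`; conjugation respects powers. The two forms give short
words for the apex from both base vertices. -/
theorem Consecutive.conj_pow {i j : Fin (n - 1)} (h : Consecutive i j) (m : ℕ) :
    (sigma i * sigma j ^ m * (sigma i)⁻¹ : BraidGroup n) =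
      (sigma j)⁻¹ * sigma i ^ m * sigma j := by
  have h1 : (sigma i * sigma j * (sigma i)⁻¹ : BraidGroup n) =
      (sigma j)⁻¹ * sigma i * sigma j := by
    rw [mul_inv_eq_iff_eq_mul, mul_assoc, mul_assoc, eq_inv_mul_iff_mul_eq, ← mul_assoc,
      ← mul_assoc, h.braid]
  have h2 := _root_.conj_pow (i := m) (a := sigma i) (b := (sigma j : BraidGroup n))
  have h3 := _root_.conj_pow (i := m) (a := (sigma j)⁻¹) (b := (sigma i : BraidGroup n))
  rw [inv_inv] at h3
  rw [← h2, ← h3, h1]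

/-- The exponent sum, as a homomorphism. -/
def expSumHom : BraidGroup n →* Multiplicative ℤ :=
  lift (fun _ => Multiplicative.ofAdd 1) (fun _ _ _ => rfl) (fun _ _ _ => rfl)

/-- The exponent sum of a braid. -/
def expSum (g : BraidGroup n) : ℤ := (expSumHom g).toAdd

theorem expSum_one : expSum (1 : BraidGroup n) = 0 := by simp [expSum]

theorem expSum_mul (g h : BraidGroup n) : expSum (g * h) = expSum g + expSum h := by
  simp [expSum]

theorem expSum_inv (g : BraidGroup n) : expSum g⁻¹ = -expSum g := by simp [expSum]

theorem expSum_zpow (g : BraidGroup n) (k : ℤ) : expSum (g ^ k) = k * expSum g := by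
  simp [expSum]

theorem expSum_pow (g : BraidGroup n) (k : ℕ) : expSum (g ^ k) = k * expSum g := by
  simp [expSum]

theorem expSum_sigma (k : Fin (n - 1)) : expSum (sigma k : BraidGroup n) = 1 := by
  simp [expSum, expSumHom, lift_sigma]

/-- The automorphism inverting the Artin generators. -/
def mirror : BraidGroup n →* BraidGroup n :=
  lift (fun k => (sigma k)⁻¹)
    (fun i j h => by simpa [mul_assoc] using congrArg (·⁻¹) (sigma_braid h))
    (fun i j h => by simpa using congrArg (·⁻¹) (sigma_comm h).symm)

theorem mirror_sigma (k : Fin (n - 1)) : mirror (sigma k : BraidGroup n) = (sigma k)⁻¹ :=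
  lift_sigma _ _ _ k

end Presentation

/-! ### Words, path lengths and signs -/

section Words

/-- `SignedWord p q g`: the braid `g` is a product of `p` Artin generators and `q` inverses of
Artin generators, in some order. -/
inductive SignedWord : ℕ → ℕ → BraidGroup n → Prop
  | one : SignedWord 0 0 1
  | mul_sigma {p q : ℕ} {g : BraidGroup n} (k : Fin (n - 1)) (h : SignedWord p q g) :
      SignedWord (p + 1) q (g * sigma k)
  | mul_inv {p q : ℕ} {g : BraidGroup n} (k : Fin (n - 1)) (h : SignedWord p q g) :
      SignedWord p (q + 1) (g * (sigma k)⁻¹)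

theorem SignedWord.mul_pow {p q : ℕ} {g : BraidGroup n} (h : SignedWord p q g)
    (k : Fin (n - 1)) (m : ℕ) : SignedWord (p + m) q (g * BraidGroup.sigma k ^ m) := by
  induction m with
  | zero => simpa using h
  | succ m ih => simpa [pow_succ, mul_assoc, add_assoc] using ih.mul_sigma k

theorem SignedWord.pow (k : Fin (n - 1)) (m : ℕ) :
    SignedWord m 0 (BraidGroup.sigma k ^ m : BraidGroup n) := by
  simpa using SignedWord.one.mul_pow k m

theorem SignedWord.expSum_eq {p q : ℕ} {g : BraidGroup n} (h : SignedWord p q g) :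
    expSum g = p - q := by
  induction h with
  | one => simp [expSum_one]
  | mul_sigma k _ ih => rw [expSum_mul, expSum_sigma, ih]; push_cast; ring
  | mul_inv k _ ih => rw [expSum_mul, expSum_inv, expSum_sigma, ih]; push_cast; ring

theorem SignedWord.mirror {p q : ℕ} {g : BraidGroup n} (h : SignedWord p q g) :
    SignedWord q p (mirror g) := by
  induction h with
  | one => simpa using SignedWord.one
  | mul_sigma k _ ih => simpa [mirror_sigma] using ih.mul_inv k
  | mul_inv k _ ih => simpa [mirror_sigma] using ih.mul_sigma k

theorem mirror_mirror (g : BraidGroup n) : mirror (mirror g) = g := by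
  suffices h : (mirror.comp mirror : BraidGroup n →* BraidGroup n) = MonoidHom.id _ from
    DFunLike.congr_fun h g
  refine PresentedGroup.ext (rels := braidRelators n) fun k => ?_
  change mirror (mirror (sigma k)) = sigma k
  rw [mirror_sigma, map_inv, mirror_sigma, inv_inv]

theorem cayleyGraph_adj_iff {u v : BraidGroup n} : (cayleyGraph n).Adj u v ↔
    u ≠ v ∧ ∃ k, v = u * sigma k ∨ v = u * (sigma k)⁻¹ := by
  rw [cayleyGraph, SimpleGraph.mulCayley_adj]
  refine and_congr_right fun _ => ⟨?_, ?_⟩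
  · rintro (⟨k, hk⟩ | ⟨k, hk⟩)
    · exact ⟨k, Or.inl (by rw [hk]; group)⟩
    · exact ⟨k, Or.inr (by rw [hk]; group)⟩
  · rintro ⟨k, rfl | rfl⟩
    · exact Or.inl ⟨k, by group⟩
    · exact Or.inr ⟨k, by group⟩

theorem dist_mul_sigma_le (u : BraidGroup n) (k : Fin (n - 1)) :
    (cayleyGraph n).dist u (u * sigma k) ≤ 1 := by
  by_cases h : u = u * sigma k
  · rw [← h]; simp
  · exact (SimpleGraph.dist_eq_one_iff_adj.mpr
      (cayleyGraph_adj_iff.mpr ⟨h, k, Or.inl rfl⟩)).le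

theorem SignedWord.dist_le {p q : ℕ} {g : BraidGroup n} (h : SignedWord p q g)
    (u : BraidGroup n) : (cayleyGraph n).dist u (u * g) ≤ p + q := by
  induction h with
  | one => simp
  | @mul_sigma p q g k _ ih =>
    have h1 := (cayleyGraph_connected n).dist_triangle (u := u) (v := u * g)
      (w := u * (g * BraidGroup.sigma k))
    have h2 := dist_mul_sigma_le (u * g) k
    rw [mul_assoc] at h2
    omega
  | @mul_inv p q g k _ ih =>
    have h1 := (cayleyGraph_connected n).dist_triangle (u := u) (v := u * g)
      (w := u * (g * (BraidGroup.sigma k)⁻¹))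
    have h2 := dist_mul_sigma_le (u * (g * (BraidGroup.sigma k)⁻¹)) k
    rw [mul_assoc u, inv_mul_cancel_right, SimpleGraph.dist_comm] at h2
    omega

theorem dist_le_of_signedWord {p q : ℕ} {u v : BraidGroup n} (h : SignedWord p q (u⁻¹ * v)) :
    (cayleyGraph n).dist u v ≤ p + q := by
  simpa using h.dist_le u

/-- Reading off the labels of a minimal path turns length and exponent sum into p + q and p - q, so
a length bound controls the number of inverse letters. -/
theorem exists_signedWord (u v : BraidGroup n) :
    ∃ p q, p + q = (cayleyGraph n).dist u v ∧ SignedWord p q (u⁻¹ * v) := by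
  obtain ⟨w, hw⟩ := (cayleyGraph_connected n).exists_walk_length_eq_dist u v
  rw [← hw]
  clear hw
  induction w using SimpleGraph.Walk.concatRec with
  | Hnil => exact ⟨0, 0, rfl, by simpa using SignedWord.one⟩
  | @Hconcat u v w r h ih =>
    obtain ⟨p, q, hpq, hg⟩ := ih
    rw [SimpleGraph.Walk.length_concat, ← hpq]
    obtain ⟨-, k, rfl | rfl⟩ := cayleyGraph_adj_iff.mp h
    · exact ⟨p + 1, q, by omega, by simpa [mul_assoc] using hg.mul_sigma k⟩
    · exact ⟨p, q + 1, by omega, by simpa [mul_assoc] using hg.mul_inv k⟩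

theorem natAbs_expSum_le_dist (u v : BraidGroup n) :
    (expSum (u⁻¹ * v)).natAbs ≤ (cayleyGraph n).dist u v := by
  obtain ⟨p, q, hpq, h⟩ := exists_signedWord u v
  rw [h.expSum_eq]
  omega

theorem dist_mirror_le (u v : BraidGroup n) :
    (cayleyGraph n).dist (mirror u) (mirror v) ≤ (cayleyGraph n).dist u v := by
  obtain ⟨p, q, hpq, h⟩ := exists_signedWord u v
  have := h.mirror
  rw [map_mul, map_inv] at this
  have := dist_le_of_signedWord this
  omega

theorem dist_mirror (u v : BraidGroup n) :
    (cayleyGraph n).dist (mirror u) (mirror v) = (cayleyGraph n).dist u v :=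
  (dist_mirror_le u v).antisymm (by
    simpa [mirror_mirror] using dist_mirror_le (mirror u) (mirror v))

theorem neighborSet_finite (v : BraidGroup n) : ((cayleyGraph n).neighborSet v).Finite := by
  refine ((Set.finite_range fun k => v * sigma k).union
    (Set.finite_range fun k => v * (sigma k)⁻¹)).subset fun w hw => ?_
  obtain ⟨-, k, h | h⟩ := cayleyGraph_adj_iff.mp hw
  · exact Or.inl ⟨k, h.symm⟩
  · exact Or.inr ⟨k, h.symm⟩

theorem countable : Countable (BraidGroup n) := by
  have : Countable (FreeGroup (Fin (n - 1))) := Quot.mk_surjective.countable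
  exact (PresentedGroup.mk_surjective (braidRelators n)).countable

end Words

/-! ### The Burau representation at t = 2 -/

section Burau

/-- The elementary operator of the Burau representation at `t = 2`. -/
def burau (p q : ℕ) (h : p ≠ q) : Equiv.Perm (ℕ → ℚ) where
  toFun v i := if i = p then 2 * v q - v p else if i = q then v p else v i
  invFun w i := if i = p then w q else if i = q then (w p + w q) / 2 else w i
  left_inv v := by
    ext i
    by_cases hp : i = p
    · simp [hp, h.symm]
    by_cases hq : i = q
    · simp [hq, h.symm]
    · simp [hp, hq]
  right_inv w := by
    ext i
    by_cases hp : i = p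
    · simp [hp, h.symm]; ring
    by_cases hq : i = q
    · simp [hq, h.symm]
    · simp [hp, hq]

theorem burau_apply {p q : ℕ} (h : p ≠ q) (v : ℕ → ℚ) (i : ℕ) :
    burau p q h v i = if i = p then 2 * v q - v p else if i = q then v p else v i := rfl

theorem burau_inv_apply {p q : ℕ} (h : p ≠ q) (v : ℕ → ℚ) (i : ℕ) :
    (burau p q h)⁻¹ v i = if i = p then v q else if i = q then (v p + v q) / 2 else v i := rfl

theorem burau_braid {p q r : ℕ} (hpq : p ≠ q) (hqr : q ≠ r) (hpr : p ≠ r) :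
    burau p q hpq * burau q r hqr * burau p q hpq =
      burau q r hqr * burau p q hpq * burau q r hqr := by
  ext v i
  simp only [Equiv.Perm.mul_apply]
  by_cases hp : i = p
  · subst hp; simp [burau_apply, hpq, hpr, hpq.symm, hqr.symm, hpr.symm]; ring
  by_cases hq : i = q
  · subst hq; simp [burau_apply, hpq, hpr, hpq.symm, hqr.symm, hpr.symm]
  by_cases hr : i = r
  · subst hr; simp [burau_apply, hpq, hpr, hpq.symm, hqr.symm, hpr.symm]
  · simp [burau_apply, hp, hq, hr]

theorem burau_comm {p q r s : ℕ} (hpq : p ≠ q) (hrs : r ≠ s) (hpr : p ≠ r) (hps : p ≠ s)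
    (hqr : q ≠ r) (hqs : q ≠ s) : burau p q hpq * burau r s hrs = burau r s hrs * burau p q hpq := by
  ext v i
  simp only [Equiv.Perm.mul_apply]
  by_cases hp : i = p
  · subst hp; simp [burau_apply, hpr, hps, hqr, hqs]
  by_cases hq : i = q
  · subst hq; simp [burau_apply, hpr, hps, hqr, hqs]
  · simp [burau_apply, hp, hq, hpr.symm, hps.symm, hqr.symm, hqs.symm]

/-- For consecutive `i, j` one of the two mirror forms of the Burau representation has the
target index of the `i`-th operator equal to the source index of the `j`-th. -/
theorem Consecutive.exists_burau {i j : Fin (n - 1)} (h : Consecutive i j) :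
    ∃ (ρ : BraidGroup n →* Equiv.Perm (ℕ → ℚ)) (P Q : Fin (n - 1) → ℕ)
      (hPQ : ∀ k, P k ≠ Q k), (∀ k, ρ (sigma k) = burau (P k) (Q k) (hPQ k)) ∧
      Function.Injective Q ∧ Q i = P j ∧ P i ≠ Q j := by
  rcases h with h | h
  · refine ⟨lift (fun k => burau k (k + 1) (by omega)) ?_ ?_, fun k => k, fun k => k + 1,
      fun k => Nat.ne_of_lt (Nat.lt_succ_self _), lift_sigma _ _ _,
      fun k l hkl => Fin.ext (by simpa using hkl), h,
      by dsimp only; omega⟩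
    · intro i j hij
      simp only [← hij]
      exact burau_braid _ _ (by omega)
    · intro i j hij
      exact burau_comm _ _ (by omega) (by omega) (by omega) (by omega)
  · refine ⟨lift (fun k => burau (k + 1) k (by omega)) ?_ ?_, fun k => k + 1, fun k => k,
      fun k => Nat.ne_of_gt (Nat.lt_succ_self _), lift_sigma _ _ _,
      fun k l hkl => Fin.ext hkl, h.symm,
      by dsimp only; omega⟩
    · intro i j hij
      simp only [← hij]
      exact (burau_braid _ _ (by omega)).symm
    · intro i j hij
      exact burau_comm _ _ (by omega) (by omega) (by omega) (by omega)

theorem burau_pow_apply_of_ne {p q : ℕ} (h : p ≠ q) (v : ℕ → ℚ) {i : ℕ} (hp : i ≠ p) (hq : i ≠ q)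
    (m : ℕ) : (burau p q h ^ m) v i = v i := by
  induction m with
  | zero => rfl
  | succ m ih => rw [pow_succ', Equiv.Perm.mul_apply, burau_apply, if_neg hp, if_neg hq, ih]

/-- All coordinates are integer multiples of `c`. -/
def InLattice (c : ℚ) (v : ℕ → ℚ) : Prop := ∀ i, ∃ z : ℤ, v i = c * z

theorem InLattice.burau {c : ℚ} {v : ℕ → ℚ} (hv : InLattice c v) {p q : ℕ} (h : p ≠ q) :
    InLattice c (burau p q h v) := by
  intro i
  rw [burau_apply]
  split_ifs
  · obtain ⟨a, ha⟩ := hv q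
    obtain ⟨b, hb⟩ := hv p
    exact ⟨2 * a - b, by rw [ha, hb]; push_cast; ring⟩
  · exact hv p
  · exact hv i

theorem InLattice.half {c : ℚ} {v : ℕ → ℚ} (hv : InLattice c v) : InLattice (c / 2) v := by
  intro i
  obtain ⟨a, ha⟩ := hv i
  exact ⟨2 * a, by rw [ha]; push_cast; ring⟩

theorem InLattice.burau_inv {c : ℚ} {v : ℕ → ℚ} (hv : InLattice c v) {p q : ℕ} (h : p ≠ q) :
    InLattice (c / 2) ((BraidGroup.burau p q h)⁻¹ v) := by
  intro i
  rw [burau_inv_apply]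
  split_ifs
  · exact hv.half q
  · obtain ⟨a, ha⟩ := hv p
    obtain ⟨b, hb⟩ := hv q
    exact ⟨a + b, by rw [ha, hb]; push_cast; ring⟩
  · exact hv.half i

/-- The coordinates are integers, and the `i`-th is odd. -/
def OddAt (i : ℕ) (v : ℕ → ℚ) : Prop := InLattice 1 v ∧ ∃ z : ℤ, v i = 2 * z + 1

/-- Modulo 2 the operator only overwrites coordinate `q` by coordinate `p`. -/
theorem OddAt.burau {i : ℕ} {v : ℕ → ℚ} (hv : OddAt i v) {p q : ℕ} (h : p ≠ q) (hi : i ≠ q) :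
    OddAt i (burau p q h v) := by
  refine ⟨hv.1.burau h, ?_⟩
  rw [burau_apply, if_neg hi]
  split_ifs with hp
  · obtain ⟨a, ha⟩ := hv.1 q
    obtain ⟨b, hb⟩ := hv.2
    exact ⟨a - b - 1, by rw [← hp, ha, hb]; push_cast; ring⟩
  · exact hv.2

theorem OddAt.burau_target {p q : ℕ} {v : ℕ → ℚ} (hv : OddAt p v) (h : p ≠ q) :
    OddAt q (BraidGroup.burau p q h v) := by
  refine ⟨hv.1.burau h, ?_⟩
  rw [burau_apply, if_neg h.symm, if_pos rfl]
  exact hv.2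

theorem OddAt.burau_pow {i : ℕ} {v : ℕ → ℚ} (hv : OddAt i v) {p q : ℕ} (h : p ≠ q) (hi : i ≠ q)
    (m : ℕ) : OddAt i ((BraidGroup.burau p q h ^ m) v) := by
  induction m with
  | zero => simpa using hv
  | succ m ih => rw [pow_succ']; exact ih.burau h hi

theorem OddAt.not_inLattice_two {i : ℕ} {v : ℕ → ℚ} (hv : OddAt i v) : ¬ InLattice 2 v := by
  intro h
  obtain ⟨a, ha⟩ := h i
  obtain ⟨b, hb⟩ := hv.2
  have : (2 * a : ℚ) = 2 * b + 1 := ha.symm.trans hb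
  have : 2 * a = 2 * b + 1 := by exact_mod_cast this
  omega

theorem oddAt_single (i : ℕ) : OddAt i (Pi.single i 1) := by
  refine ⟨fun j => ⟨if j = i then 1 else 0, ?_⟩, 0, by simp⟩
  by_cases h : j = i
  · subst h; simp
  · simp [h]

theorem inLattice_two_burau_single {p q : ℕ} (h : p ≠ q) :
    InLattice 2 (burau p q h (Pi.single q 1)) := by
  intro i
  refine ⟨if i = p then 1 else 0, ?_⟩
  by_cases hp : i = p
  · simp [burau_apply, hp, h]
  · by_cases hq : i = q <;> simp [burau_apply, hp, hq, h, h.symm]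

theorem SignedWord.inLattice {ρ : BraidGroup n →* Equiv.Perm (ℕ → ℚ)} {P Q : Fin (n - 1) → ℕ}
    {hPQ : ∀ k, P k ≠ Q k} (hρ : ∀ k, ρ (BraidGroup.sigma k) = burau (P k) (Q k) (hPQ k))
    {p q : ℕ} {g : BraidGroup n} (hg : SignedWord p q g) {c : ℚ} {v : ℕ → ℚ}
    (hv : InLattice c v) : InLattice (c / 2 ^ q) (ρ g v) := by
  induction hg generalizing c v with
  | one => simpa using hv
  | mul_sigma k _ ih =>
    rw [map_mul, hρ, Equiv.Perm.mul_apply]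
    exact ih (hv.burau _)
  | mul_inv k _ ih =>
    rw [map_mul, map_inv, hρ, Equiv.Perm.mul_apply, pow_succ', ← div_div]
    exact ih (hv.burau_inv _)

/-- A positive braid ending in the generator `k` is divisible by two on the `Q k`-th basis
vector of the Burau representation. -/
theorem SignedWord.inLattice_two {ρ : BraidGroup n →* Equiv.Perm (ℕ → ℚ)} {P Q : Fin (n - 1) → ℕ}
    {hPQ : ∀ k, P k ≠ Q k} (hρ : ∀ k, ρ (BraidGroup.sigma k) = burau (P k) (Q k) (hPQ k))
    {p : ℕ} {g : BraidGroup n} {k : Fin (n - 1)}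
    (hg : SignedWord p 0 (g * (BraidGroup.sigma k)⁻¹)) :
    InLattice 2 (ρ g (Pi.single (Q k) 1)) := by
  have h := hg.inLattice hρ (inLattice_two_burau_single (hPQ k))
  rwa [← hρ, ← Equiv.Perm.mul_apply, ← map_mul, inv_mul_cancel_right, pow_zero, div_one] at h

theorem Consecutive.eq_of_signedWord {i j : Fin (n - 1)} (h : Consecutive i j) {m p : ℕ}
    {k : Fin (n - 1)} (hg : SignedWord p 0 (sigma i ^ m * sigma j * (sigma k)⁻¹)) : k = j := by
  obtain ⟨ρ, P, Q, hPQ, hρ, hQ, hij, -⟩ := h.exists_burau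
  by_contra hk
  have hne : Q i ≠ Q j := by rw [hij]; exact hPQ j
  have h2 := hg.inLattice_two hρ
  rw [map_mul, map_pow, hρ, hρ, Equiv.Perm.mul_apply] at h2
  -- When `Q k = Q i = P j`, the operator of `j` copies the odd entry to `Q j`, which the operator
  -- of `i` preserves. Otherwise neither operator overwrites coordinate `Q k`.
  by_cases hki : Q k = Q i
  · have h0 : OddAt (P j) (Pi.single (Q k) 1) := by
      rw [hki, hij]
      exact oddAt_single _
    exact ((h0.burau_target (hPQ j)).burau_pow (hPQ i) hne.symm m
      ).not_inLattice_two h2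
  · exact (((oddAt_single (Q k)).burau (hPQ j) (hQ.ne hk)).burau_pow (hPQ i) hki m
      ).not_inLattice_two h2

theorem Consecutive.not_signedWord_sq {i j : Fin (n - 1)} (h : Consecutive i j) {m p : ℕ} :
    ¬ SignedWord p 0 (sigma i ^ 2 * sigma j ^ (m + 1) * (sigma i)⁻¹) := by
  obtain ⟨ρ, P, Q, hPQ, hρ, hQ, hij, -⟩ := h.exists_burau
  intro hg
  have hne : Q i ≠ Q j := by rw [hij]; exact hPQ j
  have h2 := hg.inLattice_two hρ
  rw [map_mul, map_pow, map_pow, hρ, hρ, Equiv.Perm.mul_apply, pow_succ' (burau (P j) _ _),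
    Equiv.Perm.mul_apply] at h2
  have h0 : OddAt (P j) (Pi.single (Q i) 1) := by
    rw [hij]
    exact oddAt_single _
  exact (((h0.burau_pow (hPQ j) (hPQ j) m).burau_target (hPQ j)).burau_pow
    (hPQ i) hne.symm 2).not_inLattice_two h2

/-- The two inverse operators each halve: the basis vector at `P j` goes to half that at `Q j = P
i`, then to entry 1/4 at `Q i`, a coordinate untouched by powers of the operator of `j`. Each
inverse letter contributes at most one factor 2 to the denominator. -/
theorem Consecutive.two_le_of_signedWord {i j : Fin (n - 1)} (h : Consecutive i j) {m p q : ℕ}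
    (hg : SignedWord p q (sigma j ^ m * (sigma i)⁻¹ * (sigma j)⁻¹)) : 2 ≤ q := by
  obtain ⟨ρ, P, Q, hPQ, hρ, -, hji, hne⟩ := h.symm.exists_burau
  have hQ : Q i ≠ Q j := by
    rw [hji]
    exact (hPQ i).symm
  have hP : P i ≠ P j := by
    rw [← hji]
    exact (hPQ j).symm
  obtain ⟨z, hz⟩ := hg.inLattice hρ (oddAt_single (P j)).1 (Q i)
  rw [map_mul, map_mul, map_pow, map_inv, map_inv, hρ, hρ, Equiv.Perm.mul_apply,
    Equiv.Perm.mul_apply, burau_pow_apply_of_ne _ _ hne.symm hQ, burau_inv_apply,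
    if_neg (hPQ i).symm, if_pos rfl, burau_inv_apply, burau_inv_apply, if_neg hP,
    if_pos hji.symm, if_neg hne.symm, if_neg hQ, Pi.single_eq_same, Pi.single_eq_of_ne (hPQ j).symm,
    Pi.single_eq_of_ne hne.symm] at hz
  by_contra hq
  obtain rfl | rfl : q = 0 ∨ q = 1 := by omega
  · have : (1 : ℚ) = 4 * z := by linarith
    have : (1 : ℤ) = 4 * z := by exact_mod_cast this
    omega
  · have : (1 : ℚ) = 2 * z := by linarith
    have : (1 : ℤ) = 2 * z := by exact_mod_cast this
    omega

end Burau

/-! ### Last edges of minimal paths -/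

section Tails

/-- No edge into `c` is closer to both `a` and `b` than `c` itself. -/
def NoCommonLastEdge (a b c : BraidGroup n) : Prop :=
  ∀ w, (cayleyGraph n).Adj w c → (cayleyGraph n).dist a w + 1 = (cayleyGraph n).dist a c →
    (cayleyGraph n).dist b w + 1 = (cayleyGraph n).dist b c → False

theorem NoCommonLastEdge.symm {a b c : BraidGroup n} (h : NoCommonLastEdge a b c) :
    NoCommonLastEdge b a c :=
  fun w hw hb ha => h w hw ha hb

theorem NoCommonLastEdge.mirror {a b c : BraidGroup n} (h : NoCommonLastEdge a b c) :
    NoCommonLastEdge (mirror a) (mirror b) (mirror c) := by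
  intro w hw ha hb
  rw [← mirror_mirror w] at hw ha hb
  rw [dist_mirror, dist_mirror] at ha hb
  rw [← SimpleGraph.dist_eq_one_iff_adj, dist_mirror, SimpleGraph.dist_eq_one_iff_adj] at hw
  exact h _ hw ha hb

variable {i j : Fin (n - 1)}

theorem dist_sigma_conj_le (m : ℕ) :
    (cayleyGraph n).dist (sigma i) (sigma i * sigma j ^ m * (sigma i)⁻¹) ≤ m + 1 := by
  refine dist_le_of_signedWord ?_
  simpa [mul_assoc] using (SignedWord.pow j m).mul_inv i

theorem Consecutive.dist_sigma_inv_conj_le (h : Consecutive i j) (m : ℕ) :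
    (cayleyGraph n).dist (sigma j)⁻¹ (sigma i * sigma j ^ m * (sigma i)⁻¹) ≤ m + 1 := by
  refine dist_le_of_signedWord (q := 0) ?_
  simpa [h.conj_pow, mul_assoc] using (SignedWord.pow i m).mul_sigma j

theorem Consecutive.noCommonLastEdge (h : Consecutive i j) (m : ℕ) :
    NoCommonLastEdge (sigma i) (sigma j)⁻¹ (sigma i * sigma j ^ m * (sigma i)⁻¹) := by
  intro w hw ha hb
  have ha' := dist_sigma_conj_le (i := i) (j := j) m
  have hb' := h.dist_sigma_inv_conj_le m
  obtain ⟨p, q, hpq, hg⟩ := exists_signedWord (sigma j)⁻¹ w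
  obtain ⟨p', q', hpq', hg'⟩ := exists_signedWord (sigma i) w
  have e := hg.expSum_eq
  have e' := hg'.expSum_eq
  obtain ⟨-, k, hk | hk⟩ := cayleyGraph_adj_iff.mp hw
  · obtain rfl : w = sigma i * sigma j ^ m * (sigma i)⁻¹ * (sigma k)⁻¹ := by
      rw [hk, mul_inv_cancel_right]
    -- The exponent sum is m and there are at most m letters.
    have hq : q = 0 := by
      simp only [expSum_mul, expSum_inv, expSum_pow, expSum_sigma] at e
      omega
    subst hq
    have hkj : k = j := h.eq_of_signedWord (m := m) (p := p) (by
      simpa [h.conj_pow, mul_assoc] using hg)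
    subst hkj
    -- Exponent sum m - 2 with two inverse letters needs length at least m + 2, against at most m.
    have := h.two_le_of_signedWord (m := m) (p := p') (q := q') (by
      simpa [mul_assoc] using hg')
    simp only [expSum_mul, expSum_inv, expSum_pow, expSum_sigma] at e'
    omega
  · obtain rfl : w = sigma i * sigma j ^ m * (sigma i)⁻¹ * sigma k := by
      rw [hk, inv_mul_cancel_right]
    simp only [expSum_mul, expSum_inv, expSum_pow, expSum_sigma] at e
    omega

/-- The exponent sum of the quotient is m + 1, so equality would need a positive word, excluded by
`Consecutive.not_signedWord_sq`. For `m = 0` the bound fails. -/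
theorem Consecutive.lt_dist_inv_conj (h : Consecutive i j) {m : ℕ} (hm : 1 ≤ m) :
    m + 2 ≤ (cayleyGraph n).dist (sigma i)⁻¹ (sigma i * sigma j ^ m * (sigma i)⁻¹) := by
  obtain ⟨p, q, hpq, hg⟩ := exists_signedWord (sigma i)⁻¹ (sigma i * sigma j ^ m * (sigma i)⁻¹)
  have e := hg.expSum_eq
  simp only [expSum_mul, expSum_inv, expSum_pow, expSum_sigma] at e
  obtain ⟨m, rfl⟩ := Nat.exists_eq_add_of_le' hm
  have hq : q ≠ 0 := by
    rintro rfl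
    exact h.not_signedWord_sq (by simpa [pow_two, mul_assoc] using hg)
  push_cast at e
  omega

end Tails

/-! ### The four families and their separation -/

section Apex

theorem apex_one_one (x y : BraidGroup n) (m : ℕ) : apex x y 1 1 m = x * y ^ m * x⁻¹ := by
  simp [apex]

theorem mirror_apex (i j : Fin (n - 1)) (ε δ : ℤˣ) (m : ℕ) :
    mirror (apex (sigma i) (sigma j) ε δ m : BraidGroup n) =
      apex (sigma i) (sigma j) (-ε) (-δ) m := by
  simp [apex, mirror_sigma]

variable {i j : Fin (n - 1)}

theorem Consecutive.apex_neg_one_one (h : Consecutive i j) (m : ℕ) :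
    (apex (sigma i) (sigma j) (-1) 1 m : BraidGroup n) =
      sigma j * sigma i ^ m * (sigma j)⁻¹ := by
  rw [h.symm.conj_pow]
  simp [apex]

theorem Consecutive.noCommonLastEdge_apex (h : Consecutive i j) (ε δ : ℤˣ) (m : ℕ) :
    NoCommonLastEdge (sigma i ^ (ε : ℤ)) (sigma j ^ (-(ε : ℤ)))
      (apex (sigma i) (sigma j) ε δ m) := by
  have h1 := h.noCommonLastEdge m
  have h2 := (h.symm.noCommonLastEdge m).symm
  -- `h1` and `h2` are the signs (1, 1) and (-1, 1), the second by exchanging i and j; their mirrors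
  -- are (-1, -1) and (1, -1).
  rw [← apex_one_one] at h1
  rw [← h.apex_neg_one_one] at h2
  have h3 := h1.mirror
  have h4 := h2.mirror
  rw [mirror_apex, map_inv, mirror_sigma, mirror_sigma] at h3 h4
  rcases Int.units_eq_one_or ε with rfl | rfl <;> rcases Int.units_eq_one_or δ with rfl | rfl
  · simpa using h1
  · simpa using h4
  · simpa using h2
  · simpa using h3

/-- The exponent sums δm - ε and δm + ε of the two quotients have absolute values adding up to at
least 2m. -/
theorem le_perimeter_apex (ε δ : ℤˣ) (m : ℕ) :
    m ≤ perimeter (cayleyGraph n) (sigma i ^ (ε : ℤ)) (sigma j ^ (-(ε : ℤ)))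
      (apex (sigma i) (sigma j) ε δ m) := by
  have h1 := natAbs_expSum_le_dist (sigma i ^ (ε : ℤ)) (apex (sigma i) (sigma j) ε δ m)
  have h2 := natAbs_expSum_le_dist (sigma j ^ (-(ε : ℤ))) (apex (sigma i) (sigma j) ε δ m)
  simp only [apex, expSum_mul, expSum_inv, expSum_zpow, expSum_sigma] at h1 h2
  rw [perimeter, SimpleGraph.dist_comm (u := apex _ _ _ _ _)]
  simp only [apex]
  rcases Int.units_eq_one_or ε with rfl | rfl <;> rcases Int.units_eq_one_or δ with rfl | rfl <;>
    simp only [Units.val_one, Units.val_neg] at h1 h2 ⊢ <;> omega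

theorem Consecutive.nonBusemannCriterion (h : Consecutive i j) (ε δ : ℤˣ) :
    NonBusemannCriterion (cayleyGraph n) (sigma i ^ (ε : ℤ)) (sigma j ^ (-(ε : ℤ)))
      (apex (sigma i) (sigma j) ε δ) where
  connected := cayleyGraph_connected n
  countable := countable
  finite_valence := neighborSet_finite
  le_perimeter := le_perimeter_apex ε δ
  not_shareTail m := not_shareTail_of_forall_adj (cayleyGraph_connected n)
    (h.noCommonLastEdge_apex ε δ m)

theorem dist_eq (u v : BraidGroup n) : dist u v = ((cayleyGraph n).dist u v : ℝ) := rfl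

theorem dist_mul_zpow_le (u : BraidGroup n) (k : Fin (n - 1)) (z : ℤ) :
    (cayleyGraph n).dist u (u * sigma k ^ z) ≤ z.natAbs := by
  have hpos : ∀ (u : BraidGroup n) (m : ℕ), (cayleyGraph n).dist u (u * sigma k ^ m) ≤ m :=
    fun u m => (SignedWord.pow k m).dist_le u
  obtain ⟨m, rfl | rfl⟩ := z.eq_nat_or_neg
  · simpa using hpos u m
  · have h := hpos (u * sigma k ^ (-(m : ℤ))) m
    rw [SimpleGraph.dist_comm] at h
    simpa using h

/-- The first point lies two letters along the word for the apex, so its distance is at most m - 1;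
the exponent sum puts the second at distance at least m + 1. With exponent 1 in place of 2 these
estimates would not separate. -/
theorem dist_apex_sub_le (ε δ ε' : ℤˣ) {m : ℕ} (hm : 2 ≤ m) :
    dist (apex (sigma i) (sigma j) ε δ m) (sigma i ^ (ε : ℤ) * sigma j ^ ((δ : ℤ) * 2)) -
      dist (apex (sigma i) (sigma j) ε δ m)
        (sigma i ^ (ε' : ℤ) * sigma j ^ (((-δ : ℤˣ) : ℤ) * 2)) ≤ -1 := by
  have h1 := dist_mul_zpow_le (sigma i ^ (ε : ℤ) * sigma j ^ ((δ : ℤ) * 2)) j (δ * (m - 2))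
  have h2 := dist_mul_zpow_le (sigma i ^ (ε : ℤ) * sigma j ^ ((δ : ℤ) * m)) i (-ε)
  rw [mul_assoc, ← zpow_add, show (δ : ℤ) * 2 + δ * (m - 2) = δ * m by ring] at h1
  have h3 := (cayleyGraph_connected n).dist_triangle
    (u := sigma i ^ (ε : ℤ) * sigma j ^ ((δ : ℤ) * 2))
    (v := sigma i ^ (ε : ℤ) * sigma j ^ ((δ : ℤ) * m))
    (w := apex (sigma i) (sigma j) ε δ m)
  have h4 := natAbs_expSum_le_dist (sigma i ^ (ε' : ℤ) * sigma j ^ (((-δ : ℤˣ) : ℤ) * 2))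
    (apex (sigma i) (sigma j) ε δ m)
  rw [← apex] at h2
  have h5 : (expSum ((sigma i ^ (ε' : ℤ) * sigma j ^ (((-δ : ℤˣ) : ℤ) * 2))⁻¹ *
      apex (sigma i) (sigma j) ε δ m)) = δ * (m + 2) - ε' := by
    simp only [apex, expSum_mul, expSum_inv, expSum_zpow, expSum_sigma, Units.val_neg]
    ring
  rw [h5] at h4
  have h6 : ((δ : ℤ) * (m - 2)).natAbs = m - 2 := by
    rcases Int.units_eq_one_or δ with rfl | rfl <;>
      simp only [Units.val_one, Units.val_neg] <;> omega
  have h7 : (-(ε : ℤ)).natAbs = 1 := by simp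
  have h8 : m + 1 ≤ ((δ : ℤ) * (m + 2) - ε').natAbs := by
    rcases Int.units_eq_one_or δ with rfl | rfl <;>
      rcases Int.units_eq_one_or ε' with rfl | rfl <;>
      simp only [Units.val_one, Units.val_neg] <;> omega
  have h9 : (cayleyGraph n).dist (sigma i ^ (ε : ℤ) * sigma j ^ ((δ : ℤ) * 2))
      (apex (sigma i) (sigma j) ε δ m) + 1 ≤
      (cayleyGraph n).dist (sigma i ^ (ε' : ℤ) * sigma j ^ (((-δ : ℤˣ) : ℤ) * 2))
        (apex (sigma i) (sigma j) ε δ m) := by omega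
  rw [dist_comm, dist_comm (apex _ _ _ _ _), dist_eq, dist_eq]
  have h10 : (_ : ℝ) ≤ _ := Nat.cast_le.mpr h9
  rw [Nat.cast_add, Nat.cast_one] at h10
  linarith

theorem disjoint_limitPoints_apex_neg (ε δ ε' : ℤˣ) :
    Disjoint (limitPoints (apex (n := n) (sigma i) (sigma j) ε δ))
      (limitPoints (apex (n := n) (sigma i) (sigma j) ε' (-δ))) := by
  refine disjoint_limitPoints (sigma i ^ (ε : ℤ) * sigma j ^ ((δ : ℤ) * 2))
    (sigma i ^ (ε' : ℤ) * sigma j ^ (((-δ : ℤˣ) : ℤ) * 2)) ?_ ?_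
  · filter_upwards [eventually_ge_atTop 2] with m hm
    exact dist_apex_sub_le ε δ ε' hm
  · filter_upwards [eventually_ge_atTop 2] with m hm
    have := dist_apex_sub_le (i := i) (j := j) ε' (-δ) ε hm
    rw [neg_neg] at this
    linarith

theorem Consecutive.dist_conj_sub_le (h : Consecutive i j) {m : ℕ} (hm : 1 ≤ m) :
    dist (sigma i * sigma j ^ m * (sigma i)⁻¹ : BraidGroup n) (sigma j)⁻¹ -
      dist (sigma i * sigma j ^ m * (sigma i)⁻¹ : BraidGroup n) (sigma i)⁻¹ ≤ -1 := by
  have h1 : (_ : ℝ) ≤ _ := Nat.cast_le.mpr (h.dist_sigma_inv_conj_le m)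
  have h2 : (_ : ℝ) ≤ _ := Nat.cast_le.mpr (h.lt_dist_inv_conj hm)
  push_cast at h1 h2
  rw [dist_comm, dist_comm (_ * _), dist_eq, dist_eq]
  linarith

theorem dist_mirror' (u v : BraidGroup n) : dist (mirror u) (mirror v) = dist u v := by
  rw [dist_eq, dist_eq, dist_mirror]

theorem Consecutive.disjoint_limitPoints_apex (h : Consecutive i j) (δ : ℤˣ) :
    Disjoint (limitPoints (apex (n := n) (sigma i) (sigma j) 1 δ))
      (limitPoints (apex (n := n) (sigma i) (sigma j) (-1) δ)) := by
  rcases Int.units_eq_one_or δ with rfl | rfl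
  · refine disjoint_limitPoints (sigma j)⁻¹ (sigma i)⁻¹ ?_ ?_
    · filter_upwards [eventually_ge_atTop 1] with m hm
      rw [apex_one_one]
      exact h.dist_conj_sub_le hm
    · filter_upwards [eventually_ge_atTop 1] with m hm
      rw [h.apex_neg_one_one]
      linarith [h.symm.dist_conj_sub_le hm]
  -- Mirroring reverses ε as well, so the two test points trade places.
  · refine disjoint_limitPoints (mirror (sigma i)⁻¹) (mirror (sigma j)⁻¹) ?_ ?_
    · filter_upwards [eventually_ge_atTop 1] with m hm
      have e := mirror_apex i j (-1) 1 m
      rw [neg_neg] at e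
      rw [← e, dist_mirror', dist_mirror', h.apex_neg_one_one]
      exact h.symm.dist_conj_sub_le hm
    · filter_upwards [eventually_ge_atTop 1] with m hm
      rw [← mirror_apex i j 1 1 m, dist_mirror', dist_mirror', apex_one_one]
      linarith [h.dist_conj_sub_le hm]

theorem Consecutive.disjoint_limitPoints_apex_of_ne (h : Consecutive i j) (ε δ ε' δ' : ℤˣ)
    (hne : (ε, δ) ≠ (ε', δ')) :
    Disjoint (limitPoints (apex (n := n) (sigma i) (sigma j) ε δ))
      (limitPoints (apex (n := n) (sigma i) (sigma j) ε' δ')) := by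
  by_cases hδ : δ' = δ
  · subst hδ
    rcases Int.units_eq_one_or ε with rfl | rfl <;> rcases Int.units_eq_one_or ε' with rfl | rfl
    · exact absurd rfl hne
    · exact h.disjoint_limitPoints_apex δ'
    · exact (h.disjoint_limitPoints_apex δ').symm
    · exact absurd rfl hne
  · rw [Int.units_ne_iff_eq_neg.mp hδ]
    exact disjoint_limitPoints_apex_neg ε δ ε'

theorem Consecutive.mem_boundary_and_not_isBusemannPoint (h : Consecutive i j) (ε δ : ℤˣ)
    {ω : Compactification (BraidGroup n)}
    (hω : ω ∈ limitPoints (apex (n := n) (sigma i) (sigma j) ε δ)) :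
    ω ∈ boundary (BraidGroup n) ∧ ¬ IsBusemannPoint ω := by
  have := discreteTopology_of_dist_eq (cayleyGraph_connected n) dist_eq
  have hc := h.nonBusemannCriterion ε δ
  exact ⟨mem_boundary_of_mem_limitPoints hc.eventually_ne hω,
    hc.not_isBusemannPoint dist_eq hω⟩

end Apex

end BraidGroup

end

theorem mainTheorem9 (n : ℕ) (hn : 3 ≤ n) :
    (∃ ω ∈ MetricCompactification.boundary (BraidGroup n),
      ¬ MetricCompactification.IsBusemannPoint ω) ∧
    ∀ i j : Fin (n - 1), (i : ℕ) + 1 = j →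
      (∀ ε δ : ℤˣ,
        MetricCompactification.NonBusemannCriterion (BraidGroup.cayleyGraph n)
          (BraidGroup.sigma i ^ (ε : ℤ)) (BraidGroup.sigma j ^ (-(ε : ℤ)))
          (BraidGroup.apex (BraidGroup.sigma i) (BraidGroup.sigma j) ε δ)) ∧
      (∀ ε δ : ℤˣ,
        (MetricCompactification.limitPoints
          (BraidGroup.apex (BraidGroup.sigma i) (BraidGroup.sigma j) ε δ)).Nonempty ∧
        ∀ ω ∈ MetricCompactification.limitPoints
            (BraidGroup.apex (BraidGroup.sigma i) (BraidGroup.sigma j) ε δ),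
          ω ∈ MetricCompactification.boundary (BraidGroup n) ∧
            ¬ MetricCompactification.IsBusemannPoint ω) ∧
      (∀ ε δ ε' δ' : ℤˣ, (ε, δ) ≠ (ε', δ') →
        Disjoint
          (MetricCompactification.limitPoints
            (BraidGroup.apex (BraidGroup.sigma i) (BraidGroup.sigma j) ε δ))
          (MetricCompactification.limitPoints
            (BraidGroup.apex (BraidGroup.sigma i) (BraidGroup.sigma j) ε' δ'))) := by
  refine ⟨?_, fun i j hij => ?_⟩
  · have h : BraidGroup.Consecutive (n := n) ⟨0, by omega⟩ ⟨1, by omega⟩ := Or.inl rfl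
    obtain ⟨ω, hω⟩ := MetricCompactification.limitPoints_nonempty
      (BraidGroup.apex (n := n) (BraidGroup.sigma ⟨0, by omega⟩)
        (BraidGroup.sigma ⟨1, by omega⟩) 1 1)
    exact ⟨ω, h.mem_boundary_and_not_isBusemannPoint 1 1 hω⟩
  · have h : BraidGroup.Consecutive i j := Or.inl hij
    exact ⟨h.nonBusemannCriterion,
      fun ε δ => ⟨MetricCompactification.limitPoints_nonempty _,
        fun ω hω => h.mem_boundary_and_not_isBusemannPoint ε δ hω⟩,
      h.disjoint_limitPoints_apex_of_ne⟩
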